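/- For a finite set $A=\{a_1,\dots,a_k\}$ of $k$ distinct integers and a positive integer $h$, let $$h^{\wedge}_{\pm}A=\Bigl\{\sum_{i=1}^{k}\lambda_i a_i:\ \lambda_i\in\{-1,0,1\}\ \text{for } i=1,\dots,k,\ \ \sum_{i=1}^{k}|\lambda_i|=h\Bigr\}$$ be the restricted $h$-fold signed sumset of $A$, and let $-A=\{-a: a\in A\}$. **Theorem.** Let $h$ and $k$ be positive integers with $3\le h\le k-1$ and $k\ge 5$. If $A$ is a set of $k$ integers such that $A\cap(-A)=\{0\}$, then $$|h^{\wedge}_{\pm}A|\ \ge\ 2hk-h(h+1)+1.$$ This lower bound is best possible: for all such $h$ and $k$ there is a set $A$ of $k$ integers with $A\cap(-A)=\{0\}$ for which equality holds. -/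

import Mathlib

open scoped Pointwise

/-- The restricted `h`-fold signed sumset of a finite subset `A` of an additive abelian group:
all sums `∑ a ∈ A, c a • a` with coefficients `c a ∈ {-1, 0, 1}` and `∑ a ∈ A, |c a| = h`. -/
def restrictedSignedSumset {G : Type*} [AddCommGroup G] (h : ℕ) (A : Finset G) : Set G :=
  {x | ∃ c : G → ℤ, (∀ a ∈ A, c a = -1 ∨ c a = 0 ∨ c a = 1) ∧
    ∑ a ∈ A, |c a| = (h : ℤ) ∧ x = ∑ a ∈ A, c a • a}

/-- The restricted signed sumset is finite, so that `Set.ncard` is its number of elements. -/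
theorem restrictedSignedSumset_finite {G : Type*} [AddCommGroup G] (h : ℕ) (A : Finset G) :
    (restrictedSignedSumset h A).Finite := by
  classical
  refine Set.Finite.subset
    (((Fintype.piFinset fun _ : A => ({-1, 0, 1} : Finset ℤ)).image
      fun c => ∑ a : A, c a • (a : G)).finite_toSet) ?_
  rintro x ⟨c, hc, -, rfl⟩
  simp only [Finset.coe_image, Set.mem_image, Finset.mem_coe, Fintype.mem_piFinset]
  refine ⟨fun a => c a, fun a => ?_, ?_⟩
  · simpa using hc a a.2
  · exact Finset.sum_coe_sort A (fun a => c a • a)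

/-! Changing the signs of elements of `A` does not change the sumset, and the element 0 may take any
coefficient. So the question concerns the set `B` of the n = k - 1 absolute values of the nonzero
elements, with h or h - 1 signed summands; the bound to prove is 2hn - h(h - 1) + 1.

Inserting a new maximum m creates h sums above all the old ones (trade one member of the best
h-subset for m) and their negatives, hence 2h new sums (`card_signedSums_insert`). This reduces to h
= n. There at most one coefficient vanishes, and reflecting in the total of `B` turns the sums into
`nearlyDoubledSums B`; n(n + 1) + 1 of them are needed. A new maximum m shifts the old sums to at
least 2m, so it suffices that 2n sums lie below 2m. This is `two_mul_card_le`, the heart of the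
proof, which counts residues modulo m or m / 2.

The exceptional triple {a, 2a, 4a} has one sum too few, so the inductions start at four elements: n
= 4 when h = 3, and n = h otherwise. For sharpness, the sums from {0, ..., k - 1} lie in a symmetric
interval of exactly the right size. -/

/-! ### Counting sums below twice the maximum. -/

/-- Arithmetic core of `two_mul_card_le_of_even_max`: the set `V` with even maximum `2 * μ` cannot
have so few sums `v + 2 * w` below `4 * μ` that the four listed closure properties hold. -/
theorem no_extremal_configuration (V : Finset ℤ) (μ : ℤ) (hm : 2 * μ ∈ V)
    (hpos : ∀ v ∈ V, 0 < v) (hle : ∀ v ∈ V, v ≤ 2 * μ) (h3 : 3 ≤ V.card)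
    {o : ℤ} (ho : o ∈ V) (hodd : o % 2 = 1)
    (hE : ∀ v ∈ V, ∀ w ∈ V, v ≠ w → v % 2 = 0 → 2 * μ < v + 2 * w → v + 2 * w < 4 * μ →
      ∃ y, 0 < y ∧ y < μ ∧ (y ∈ V ∨ y + μ ∈ V) ∧ v + 2 * w = 2 * μ + 2 * y)
    (hLo : ∀ v ∈ V, ∀ w ∈ V, v ≠ w → v + 2 * w < 2 * μ → v + 2 * w ∈ V)
    (hOd : ∀ v ∈ V, ∀ w ∈ V, v ≠ w → v % 2 = 1 → 2 * μ < v + 2 * w → v + 2 * w < 4 * μ →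
      (w < μ ∧ w + μ ∈ V) ∨ (μ ≤ w ∧ w < 2 * μ ∧ (w = μ ∨ w - μ ∈ V)))
    (hEx : ∀ v ∈ V, v % 2 = 1 → (v < μ ∧ v + μ ∈ V ∧ 2 * μ < 3 * v) ∨
      (μ ≤ v ∧ (v = μ ∨ v - μ ∈ V) ∧ 3 * (v - μ) < μ)) : False := by
  have hμ : 0 < μ := by have := hpos _ hm; omega
  -- If `μ` is even, `hEx` pairs an odd element with another one differing from it by `μ`. With s
  -- the smaller of the two, it demands both 2μ < 3s and 3s < μ.
  rcases Int.emod_two_eq_zero_or_one μ with hμ2 | hμ2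
  · rcases hEx o ho hodd with ⟨h1, h2, h4⟩ | ⟨h1, h2, h4⟩
    · rcases hEx _ h2 (by omega) with h | h <;> omega
    · have h2 : o - μ ∈ V := by rcases h2 with h2 | h2; · omega
                                · exact h2
      have := hpos _ h2
      rcases hEx _ h2 (by omega) with h | h <;> omega
  -- the largest odd element
  obtain ⟨q, hq, hqmax⟩ := (V.filter (fun v => v % 2 = 1)).exists_max_image id
    ⟨o, by simp [ho, hodd]⟩
  simp only [Finset.mem_filter, id] at hq hqmax
  obtain ⟨hqV, hq2⟩ := hq
  have hqm : ∀ v ∈ V, v % 2 = 1 → v ≤ q := fun v hv h => hqmax v ⟨hv, h⟩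
  have hqpos := hpos q hqV
  -- the largest element below `2 * μ`
  obtain ⟨e, he, hemax⟩ := (V.erase (2 * μ)).exists_max_image id
    ⟨q, by rw [Finset.mem_erase]; exact ⟨by omega, hqV⟩⟩
  simp only [Finset.mem_erase, id] at he hemax
  obtain ⟨hem, heV⟩ := he
  have hem' : e < 2 * μ := by have := hle e heV; omega
  have hemx : ∀ v ∈ V, v < 2 * μ → v ≤ e := fun v hv h => hemax v ⟨by omega, hv⟩
  rcases hEx q hqV hq2 with ⟨h1, h2, h4⟩ | ⟨h1, h2, h4⟩
  · -- `q < μ`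
    have hlow : ∀ v ∈ V, v < μ → v + μ ∈ V ∧ (v = q ∨ 2 * μ < q + 2 * v) := by
      intro v hv hvμ
      by_cases hvq : v = q
      · exact ⟨hvq ▸ h2, Or.inl hvq⟩
      have hvpos := hpos v hv
      have hgt : 2 * μ < q + 2 * v := by
        by_contra hcon
        have := hqm _ (hLo q hqV v hv (Ne.symm hvq) (by omega)) (by omega)
        omega
      rcases hOd q hqV v hv (Ne.symm hvq) hq2 hgt (by omega) with h | h
      · exact ⟨h.2, Or.inr hgt⟩
      · omega
    -- the largest gap smaller than `2 * (μ - q)`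
    obtain ⟨f, hf, hfmin⟩ := (V.filter (fun v => 2 * μ - v < 2 * (μ - q) ∧ v < 2 * μ)).exists_min_image
      id ⟨q + μ, by simp only [Finset.mem_filter]; exact ⟨h2, by omega, by omega⟩⟩
    simp only [Finset.mem_filter, id] at hf hfmin
    obtain ⟨hfV, hf1, hf2⟩ := hf
    have hfq : f ≤ q + μ := hfmin _ ⟨h2, by omega, by omega⟩
    have hfe : f % 2 = 0 := by
      rcases Int.emod_two_eq_zero_or_one f with h | h
      · exact h
      · have := hqm f hfV h; omega
    -- Here y + μ = f / 2 + q lies strictly between 2q and `f`, against the minimality of `f` among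
    -- the elements above 2q.
    obtain ⟨y, hy0, hyμ, hyV, hy⟩ := hE f hfV q hqV (by omega) hfe (by omega) (by omega)
    have hyV' : y + μ ∈ V := by
      rcases hyV with h | h
      · exact (hlow y h hyμ).1
      · exact h
    have := hfmin (y + μ) ⟨hyV', by omega, by omega⟩
    omega
  · by_cases hqμ : q = μ
    · subst hqμ
      have hlow : ∀ v ∈ V, v < q → v + q ∈ V := by
        intro v hv hvμ
        have hvpos := hpos v hv
        have hgt : 2 * q < q + 2 * v := by
          by_contra hcon
          have := hqm _ (hLo q hqV v hv (by omega) (by omega)) (by omega)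
          omega
        rcases hOd q hqV v hv (by omega) hq2 hgt (by omega) with h | h
        · exact h.2
        · omega
      have hqe : q < e := by
        have hc : ∃ v ∈ V, v ≠ q ∧ v ≠ 2 * q := by
          by_contra! hcon
          have : V ⊆ {q, 2 * q} := by
            intro v hv
            by_cases h : v = q
            · simp [h]
            · simp [hcon v hv h]
          have := (Finset.card_le_card this).trans Finset.card_le_two
          omega
        obtain ⟨v, hv, hv1, hv2⟩ := hc
        have hvm := hle v hv
        rcases lt_or_gt_of_ne hv1 with h | h
        · have := hemx _ (hlow v hv h) (by omega)
          have := hpos v hv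
          omega
        · have := hemx v hv (by omega)
          omega
      have hee : e % 2 = 0 := by
        rcases Int.emod_two_eq_zero_or_one e with h | h
        · exact h
        · have := hqm e heV h; omega
      -- Now y = e / 2, so y + q is the midpoint of `e` and 2q: an element above `e` and below the
      -- maximum.
      obtain ⟨y, hy0, hyμ, hyV, hy⟩ := hE e heV q hqV (by omega) hee (by omega) (by omega)
      have hyV' : y + q ∈ V := by
        rcases hyV with h | h
        · exact hlow y h hyμ
        · exact h
      have := hemx _ hyV' (by omega)
      omega
    · have h2' : q - μ ∈ V := by rcases h2 with h2 | h2; · omega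
                                 · exact h2
      have := hpos _ h2'
      -- The sum q + 2(q - μ) is odd, exceeds `q`, and is below 2μ because 3(q - μ) < μ.
      have := hqm _ (hLo q hqV _ h2' (by omega) (by omega)) (by omega)
      omega

/-- Reduce 0 and `V` modulo μ: `K` is the set of residues hit and `P` the set of those hit both from
below μ and from [μ, 2μ). The sums 0, `V` and the even sums 2μ + 2y with y in `K` supply 2|V| - |P|
members of `L`. Each odd v adds sums congruent to v + 2p modulo 2μ, p in `P`, with at most one
failure. A shortage therefore forces exactly one failure for every odd v and determines `L`
completely, which `no_extremal_configuration` excludes. -/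
theorem two_mul_card_le_of_even_max (V L : Finset ℤ) (μ : ℤ) (hm : 2 * μ ∈ V)
    (hpos : ∀ v ∈ V, 0 < v) (hle : ∀ v ∈ V, v ≤ 2 * μ) (h3 : 3 ≤ V.card)
    {o : ℤ} (ho : o ∈ V) (hodd : o % 2 = 1) (h0 : 0 ∈ L) (hV : V ⊆ L)
    (h2 : ∀ v ∈ V, v < 2 * μ → 2 * v ∈ L)
    (h12 : ∀ v ∈ V, ∀ w ∈ V, v ≠ w → v + 2 * w < 4 * μ → v + 2 * w ∈ L) :
    2 * V.card ≤ L.card := by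
  by_contra! hlt
  have hμ : 0 < μ := by have := hpos _ hm; omega
  set A₁ : Finset ℤ := insert 0 (V.filter (· < μ)) with hA₁
  set A₂ : Finset ℤ := ((V.filter (μ ≤ ·)).erase (2 * μ)).image (· - μ) with hA₂
  have memA₁ : ∀ x, x ∈ A₁ ↔ x = 0 ∨ (x ∈ V ∧ x < μ) := by intro x; simp [hA₁]
  have memA₂ : ∀ x, x ∈ A₂ ↔ x + μ ∈ V ∧ 0 ≤ x ∧ x < μ := by
    intro x
    simp only [hA₂, Finset.mem_image, Finset.mem_erase, Finset.mem_filter]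
    constructor
    · rintro ⟨v, ⟨hv1, hv2, hv3⟩, rfl⟩
      have := hle v hv2
      exact ⟨by simpa using hv2, by omega, by omega⟩
    · rintro ⟨hx1, hx2, hx3⟩
      exact ⟨x + μ, ⟨by omega, hx1, by omega⟩, by omega⟩
  have hAcard : A₁.card + A₂.card = V.card := by
    rw [hA₁, hA₂, Finset.card_insert_of_notMem, Finset.card_image_of_injective,
      Finset.card_erase_of_mem]
    · have := Finset.card_filter_add_card_filter_not (s := V) (· < μ)
      simp only [not_lt] at this
      have hp : 0 < (V.filter (μ ≤ ·)).card :=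
        Finset.card_pos.2 ⟨2 * μ, by simp only [Finset.mem_filter]; exact ⟨hm, by omega⟩⟩
      omega
    · simp only [Finset.mem_filter]; exact ⟨hm, by omega⟩
    · intro x y; simp
    · intro h
      have := hpos 0 (Finset.mem_filter.1 h).1
      omega
  set K := A₁ ∪ A₂ with hK
  set P := A₁ ∩ A₂ with hP
  have hKP : K.card + P.card = V.card := by
    rw [hK, hP, Finset.card_union_add_card_inter, hAcard]
  have memP : ∀ p, p ∈ P ↔ (p = 0 ∨ p ∈ V) ∧ p + μ ∈ V ∧ 0 ≤ p ∧ p < μ := by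
    intro p
    rw [hP, Finset.mem_inter, memA₁, memA₂]
    tauto
  have memK : ∀ y, y ∈ K → y ≠ 0 → 0 < y ∧ y < μ ∧ (y ∈ V ∨ y + μ ∈ V) := by
    intro y hy hy0
    rw [hK, Finset.mem_union, memA₁, memA₂] at hy
    rcases hy with (h | h) | h
    · exact absurd h hy0
    · exact ⟨hpos y h.1, h.2, Or.inl h.1⟩
    · exact ⟨by omega, h.2.2, Or.inr h.1⟩
  set Q := (K.erase 0).image (fun y => 2 * μ + 2 * y) with hQ
  have memQ : ∀ x, x ∈ Q → ∃ y, 0 < y ∧ y < μ ∧ (y ∈ V ∨ y + μ ∈ V) ∧ x = 2 * μ + 2 * y := by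
    intro x hx
    simp only [hQ, Finset.mem_image, Finset.mem_erase] at hx
    obtain ⟨y, ⟨hy0, hyK⟩, rfl⟩ := hx
    obtain ⟨a, b, c⟩ := memK y hyK hy0
    exact ⟨y, a, b, c, rfl⟩
  have hQcard : Q.card + 1 = K.card := by
    rw [hQ, Finset.card_image_of_injective]
    · exact Finset.card_erase_add_one (by rw [hK, Finset.mem_union, memA₁]; simp)
    · intro x y h; simpa using h
  have hQL : Q ⊆ L := by
    intro x hx
    obtain ⟨y, hy0, hyμ, hy | hy, rfl⟩ := memQ x hx
    · exact h12 _ hm y hy (by omega) (by omega)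
    · have := h2 _ hy (by omega)
      rwa [show 2 * μ + 2 * y = 2 * (y + μ) by ring]
  set W := insert 0 V ∪ Q with hW
  have hWcard : W.card = V.card + K.card := by
    rw [hW, Finset.card_union_of_disjoint, Finset.card_insert_of_notMem]
    · omega
    · intro h; have := hpos 0 h; omega
    · rw [Finset.disjoint_left]
      intro x hx hx'
      obtain ⟨y, hy0, hyμ, -, rfl⟩ := memQ x hx'
      rcases Finset.mem_insert.1 hx with h | h
      · omega
      · have := hle _ h; omega
  have hWL : W ⊆ L := by
    intro x hx
    rw [hW, Finset.mem_union, Finset.mem_insert] at hx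
    rcases hx with (rfl | h) | h
    · exact h0
    · exact hV h
    · exact hQL h
  have hrest : (L \ W).card < P.card := by
    have := Finset.card_sdiff_add_card_eq_card hWL
    omega
  have key : ∀ v ∈ V, v % 2 = 1 → ∃ p₀ ∈ P,
      ((v = p₀ + μ ∧ v + 2 * p₀ < 2 * μ) ∨ (v = p₀ ∧ 2 * μ < v + 2 * p₀)) ∧
      ∀ x ∈ L, x ∈ W ∨ ∃ p ∈ P, 2 * μ < x ∧ x < 4 * μ ∧
        (x = v + 2 * p ∨ x = v + 2 * p + 2 * μ) := by
    intro v hv hv2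
    have hvm : v < 2 * μ := by have := hle v hv; omega
    have hv0 := hpos v hv
    -- The representative of v + 2p modulo 2μ in (2μ, 4μ). It is odd, hence outside `Q`, and too
    -- large for `V`.
    set r : ℤ → ℤ := fun p => if v + 2 * p < 2 * μ then v + 2 * p + 2 * μ else v + 2 * p with hr
    have hr1 : ∀ p, (v + 2 * p < 2 * μ ∧ r p = v + 2 * p + 2 * μ) ∨
        (2 * μ < v + 2 * p ∧ r p = v + 2 * p) := by
      intro p
      by_cases h : v + 2 * p < 2 * μ
      · exact Or.inl ⟨h, by simp [hr, h]⟩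
      · exact Or.inr ⟨by omega, by simp [hr, h]⟩
    have hinj : Set.InjOn r P := by
      intro p hp p' hp' h
      have h1 := (memP p).1 hp
      have h2 := (memP p').1 hp'
      rcases hr1 p with a | a <;> rcases hr1 p' with b | b <;> omega
    have hrW : ∀ p ∈ P, r p ∉ W := by
      intro p hp hW'
      have h1 := (memP p).1 hp
      rw [hW, Finset.mem_union, Finset.mem_insert] at hW'
      rcases hW' with (h | h) | h
      · rcases hr1 p with a | a <;> omega
      · have := hle _ h
        rcases hr1 p with a | a <;> omega
      · obtain ⟨y, _, _, -, h⟩ := memQ _ h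
        rcases hr1 p with a | a <;> omega
    have hrL : ∀ p ∈ P, ¬((v = p + μ ∧ v + 2 * p < 2 * μ) ∨ (v = p ∧ 2 * μ < v + 2 * p)) →
        r p ∈ L := by
      intro p hp hex
      obtain ⟨h1, h4, h5, h6⟩ := (memP p).1 hp
      rcases hr1 p with ⟨a, b⟩ | ⟨a, b⟩
      · rw [b, show v + 2 * p + 2 * μ = v + 2 * (p + μ) by ring]
        exact h12 v hv _ h4 (by omega) (by omega)
      · rw [b]
        rcases h1 with h1 | h1
        · omega
        · exact h12 v hv p h1 (by omega) (by omega)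
    -- The representation v + 2w of `r p`, with w = p or w = p + μ, is unavailable only when w = v.
    -- Without such a `p`, all |P| values would lie in `L \ W`, which is too small.
    have hexc : ∃ p₀ ∈ P,
        (v = p₀ + μ ∧ v + 2 * p₀ < 2 * μ) ∨ (v = p₀ ∧ 2 * μ < v + 2 * p₀) := by
      by_contra! hcon
      have hsub : P.image r ⊆ L \ W := by
        intro x hx
        obtain ⟨p, hp, rfl⟩ := Finset.mem_image.1 hx
        refine Finset.mem_sdiff.2 ⟨hrL p hp ?_, hrW p hp⟩
        have := hcon p hp
        omega
      have := Finset.card_le_card hsub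
      rw [Finset.card_image_of_injOn hinj] at this
      omega
    obtain ⟨p₀, hp₀, hexc⟩ := hexc
    refine ⟨p₀, hp₀, hexc, ?_⟩
    have hp₀' := (memP p₀).1 hp₀
    have hsub : (P.erase p₀).image r ⊆ L \ W := by
      intro x hx
      obtain ⟨p, hp, rfl⟩ := Finset.mem_image.1 hx
      obtain ⟨hne, hp⟩ := Finset.mem_erase.1 hp
      refine Finset.mem_sdiff.2 ⟨hrL p hp ?_, hrW p hp⟩
      have := (memP p).1 hp
      omega
    have heq : (P.erase p₀).image r = L \ W := by
      refine Finset.eq_of_subset_of_card_le hsub ?_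
      rw [Finset.card_image_of_injOn (hinj.mono (by simp)), Finset.card_erase_of_mem hp₀]
      omega
    intro x hx
    by_cases hxW : x ∈ W
    · exact Or.inl hxW
    · right
      have : x ∈ (P.erase p₀).image r := by rw [heq]; exact Finset.mem_sdiff.2 ⟨hx, hxW⟩
      obtain ⟨p, hp, rfl⟩ := Finset.mem_image.1 this
      have hp := (Finset.mem_erase.1 hp).2
      have := (memP p).1 hp
      refine ⟨p, hp, ?_⟩
      rcases hr1 p with ⟨a, b⟩ | ⟨a, b⟩
      · exact ⟨by omega, by omega, Or.inr b⟩
      · exact ⟨by omega, by omega, Or.inl b⟩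
  have memW : ∀ x, x ∈ W → x = 0 ∨ x ∈ V ∨
      ∃ y, 0 < y ∧ y < μ ∧ (y ∈ V ∨ y + μ ∈ V) ∧ x = 2 * μ + 2 * y := by
    intro x hx
    rw [hW, Finset.mem_union, Finset.mem_insert] at hx
    rcases hx with (h | h) | h
    · exact Or.inl h
    · exact Or.inr (Or.inl h)
    · exact Or.inr (Or.inr (memQ x h))
  -- Each sum v + 2w is located in `W` or among the odd values `r p`; parity and size decide which.
  refine no_extremal_configuration V μ hm hpos hle h3 ho hodd ?_ ?_ ?_ ?_
  · intro v hv w hw hne hv2 hgt hlt'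
    obtain ⟨p₀, -, -, hall⟩ := key o ho hodd
    rcases hall _ (h12 v hv w hw hne hlt') with h | ⟨p, -, h⟩
    · rcases memW _ h with h | h | h
      · omega
      · have := hle _ h; omega
      · exact h
    · omega
  · intro v hv w hw hne hlt'
    have := hpos v hv
    have := hpos w hw
    obtain ⟨p₀, -, -, hall⟩ := key o ho hodd
    rcases hall _ (h12 v hv w hw hne (by omega)) with h | ⟨p, -, h⟩
    · rcases memW _ h with h | h | ⟨y, h⟩
      · omega
      · exact h
      · omega
    · omega
  · intro v hv w hw hne hv2 hgt hlt'
    obtain ⟨p₀, -, -, hall⟩ := key v hv hv2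
    have hw0 := hpos w hw
    rcases hall _ (h12 v hv w hw hne hlt') with h | ⟨p, hp, h⟩
    · rcases memW _ h with h | h | ⟨y, h⟩
      · omega
      · have := hle _ h; omega
      · omega
    · obtain ⟨a, b, c, d⟩ := (memP p).1 hp
      rcases h.2.2 with h | h
      · left
        have : w = p := by omega
        subst this
        exact ⟨d, b⟩
      · right
        have : w = p + μ := by omega
        subst this
        refine ⟨by omega, by omega, ?_⟩
        rcases a with a | a
        · left; omega
        · right; simpa using a
  · intro v hv hv2
    obtain ⟨p₀, hp, hexc, -⟩ := key v hv hv2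
    obtain ⟨a, b, c, d⟩ := (memP p₀).1 hp
    rcases hexc with ⟨h, h'⟩ | ⟨h, h'⟩
    · right
      subst h
      refine ⟨by omega, ?_, by omega⟩
      rcases a with a | a
      · left; omega
      · right; simpa using a
    · left
      subst h
      exact ⟨d, b, by omega⟩

/-- Doubling is injective modulo an odd m. So each v < m gives its own sum in (m, 2m), namely 2v or
m + 2v, in addition to 0 and `V`. -/
theorem two_mul_card_le_of_odd_max (V L : Finset ℤ) (m : ℤ) (hm : m ∈ V) (hm2 : m % 2 = 1)
    (hpos : ∀ v ∈ V, 0 < v) (hle : ∀ v ∈ V, v ≤ m) (h0 : 0 ∈ L) (hV : V ⊆ L)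
    (h2 : ∀ v ∈ V, v < m → 2 * v ∈ L)
    (h12 : ∀ v ∈ V, ∀ w ∈ V, v ≠ w → v + 2 * w < 2 * m → v + 2 * w ∈ L) :
    2 * V.card ≤ L.card := by
  set f : ℤ → ℤ := fun v => if 2 * v < m then m + 2 * v else 2 * v with hf
  have hf1 : ∀ v, (2 * v < m ∧ f v = m + 2 * v) ∨ (m < 2 * v ∧ f v = 2 * v) := by
    intro v
    by_cases h : 2 * v < m
    · exact Or.inl ⟨h, by simp [hf, h]⟩
    · exact Or.inr ⟨by omega, by simp [hf, h]⟩
  have hinj : Function.Injective f := by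
    intro v w h
    rcases hf1 v with a | a <;> rcases hf1 w with b | b <;> omega
  have hsub : insert 0 V ∪ (V.erase m).image f ⊆ L := by
    intro x hx
    rw [Finset.mem_union, Finset.mem_insert] at hx
    rcases hx with (rfl | h) | h
    · exact h0
    · exact hV h
    · obtain ⟨v, hv, rfl⟩ := Finset.mem_image.1 h
      obtain ⟨hvm, hv⟩ := Finset.mem_erase.1 hv
      have := hle v hv
      rcases hf1 v with ⟨a, b⟩ | ⟨a, b⟩
      · rw [b]; exact h12 m hm v hv (by omega) (by omega)
      · rw [b]; exact h2 v hv (by omega)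
  have hdisj : Disjoint (insert 0 V) ((V.erase m).image f) := by
    rw [Finset.disjoint_left]
    intro x hx hx'
    obtain ⟨v, hv, rfl⟩ := Finset.mem_image.1 hx'
    have hv := (Finset.mem_erase.1 hv).2
    have := hpos v hv
    have := hpos m hm
    rcases Finset.mem_insert.1 hx with h | h
    · rcases hf1 v with a | a <;> omega
    · have := hle _ h
      rcases hf1 v with a | a <;> omega
  have hc := Finset.card_le_card hsub
  rw [Finset.card_union_of_disjoint hdisj, Finset.card_image_of_injective _ hinj,
    Finset.card_erase_of_mem hm, Finset.card_insert_of_notMem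
      (fun h => by have := hpos 0 h; omega)] at hc
  have : 0 < V.card := Finset.card_pos.2 ⟨m, hm⟩
  omega

/-- A set `V` of at least three positive integers with maximum `m` has at least `2 * #V` integers
below `2 * m` among `0`, `v`, `2 * v`, `v + 2 * w`. -/
theorem two_mul_card_le (V L : Finset ℤ) (m : ℤ) (hm : m ∈ V)
    (hpos : ∀ v ∈ V, 0 < v) (hle : ∀ v ∈ V, v ≤ m) (h3 : 3 ≤ V.card) (h0 : 0 ∈ L) (hV : V ⊆ L)
    (h2 : ∀ v ∈ V, v < m → 2 * v ∈ L)
    (h12 : ∀ v ∈ V, ∀ w ∈ V, v ≠ w → v + 2 * w < 2 * m → v + 2 * w ∈ L) :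
    2 * V.card ≤ L.card := by
  -- Induction on a bound for the maximum: when all of `V` is even, halving everything lowers the
  -- maximum.
  obtain ⟨N, hN⟩ : ∃ N : ℕ, m.toNat ≤ N := ⟨_, le_rfl⟩
  induction N generalizing V L m with
  | zero => have := hpos m hm; omega
  | succ N ih =>
    have hm0 := hpos m hm
    by_cases hall : ∀ v ∈ V, v % 2 = 0
    · have hinj : Set.InjOn (fun x : ℤ => x / 2) V := by
        intro x hx y hy h
        have := hall x hx
        have := hall y hy
        simp only at h
        omega
      have hmem : ∀ w ∈ V.image (· / 2), 2 * w ∈ V := by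
        intro w hw
        obtain ⟨v, hv, rfl⟩ := Finset.mem_image.1 hw
        have := hall v hv
        rwa [show 2 * (v / 2) = v by omega]
      have hL : ∀ x, 2 * x ∈ L → x ∈ (L.filter (fun x => x % 2 = 0)).image (· / 2) := by
        intro x hx
        exact Finset.mem_image.2 ⟨2 * x, Finset.mem_filter.2 ⟨hx, by omega⟩, by omega⟩
      have hmm := hall m hm
      have hVc := Finset.card_image_of_injOn hinj
      have := ih (V.image (· / 2)) ((L.filter (fun x => x % 2 = 0)).image (· / 2)) (m / 2)
        (Finset.mem_image_of_mem _ hm)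
        (fun w hw => by have := hpos _ (hmem w hw); omega)
        (fun w hw => by have := hle _ (hmem w hw); omega) (by omega)
        (hL 0 (by simpa using h0)) (fun w hw => hL w (hV (hmem w hw)))
        (fun w hw hlt => hL _ (h2 _ (hmem w hw) (by omega)))
        (fun v hv w hw hne hlt => hL _ (by
          have := h12 _ (hmem v hv) _ (hmem w hw) (by omega) (by omega)
          rwa [show 2 * (v + 2 * w) = 2 * v + 2 * (2 * w) by ring])) (by omega)
      have h5 : ((L.filter (fun x => x % 2 = 0)).image (· / 2)).card ≤ L.card :=
        Finset.card_image_le.trans (Finset.card_filter_le _ _)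
      omega
    · push Not at hall
      obtain ⟨o, ho, hodd⟩ := hall
      rcases Int.emod_two_eq_zero_or_one m with hm2 | hm2
      · obtain ⟨μ, rfl⟩ : ∃ μ, m = 2 * μ := ⟨m / 2, by omega⟩
        exact two_mul_card_le_of_even_max V L μ hm hpos hle h3 ho (by omega) h0 hV h2
          (fun v hv w hw hne hlt => h12 v hv w hw hne (by omega))
      · exact two_mul_card_le_of_odd_max V L m hm hm2 hpos hle h0 hV h2 h12

/-! ### The case h = n: nearly doubled sums. -/

/-- The sums `∑ b ∈ B, c b * b` with coefficients `c b ∈ {0, 1, 2}`, at most one of which is `1`. -/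
def nearlyDoubledSums (B : Finset ℤ) : Finset ℤ :=
  ((B.powerset ×ˢ B.powerset).filter (fun p => Disjoint p.1 p.2 ∧ p.2.card ≤ 1)).image
    (fun p => 2 * ∑ x ∈ p.1, x + ∑ x ∈ p.2, x)

theorem mem_nearlyDoubledSums {B : Finset ℤ} {t : ℤ} :
    t ∈ nearlyDoubledSums B ↔ ∃ X Y : Finset ℤ, X ⊆ B ∧ Y ⊆ B ∧ Disjoint X Y ∧ Y.card ≤ 1 ∧
      t = 2 * ∑ x ∈ X, x + ∑ x ∈ Y, x := by
  simp only [nearlyDoubledSums, Finset.mem_image, Finset.mem_filter, Finset.mem_product,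
    Finset.mem_powerset, Prod.exists]
  constructor
  · rintro ⟨X, Y, ⟨⟨h1, h2⟩, h3, h4⟩, h5⟩
    exact ⟨X, Y, h1, h2, h3, h4, h5.symm⟩
  · rintro ⟨X, Y, h1, h2, h3, h4, h5⟩
    exact ⟨X, Y, ⟨⟨h1, h2⟩, h3, h4⟩, h5.symm⟩

theorem nearlyDoubledSums_mono {B C : Finset ℤ} (h : B ⊆ C) :
    nearlyDoubledSums B ⊆ nearlyDoubledSums C := by
  intro t ht
  obtain ⟨X, Y, h1, h2, h3⟩ := mem_nearlyDoubledSums.1 ht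
  exact mem_nearlyDoubledSums.2 ⟨X, Y, h1.trans h, h2.trans h, h3⟩

theorem zero_mem_nearlyDoubledSums (B : Finset ℤ) : 0 ∈ nearlyDoubledSums B :=
  mem_nearlyDoubledSums.2 ⟨∅, ∅, by simp⟩

theorem two_mul_add_mem_nearlyDoubledSums {B : Finset ℤ} {m t : ℤ} (hm : m ∉ B)
    (ht : t ∈ nearlyDoubledSums B) : 2 * m + t ∈ nearlyDoubledSums (insert m B) := by
  obtain ⟨X, Y, h1, h2, h3, h4, rfl⟩ := mem_nearlyDoubledSums.1 ht
  refine mem_nearlyDoubledSums.2 ⟨insert m X, Y, Finset.insert_subset_insert _ h1,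
    h2.trans (Finset.subset_insert _ _), ?_, h4, ?_⟩
  · exact Finset.disjoint_insert_left.2 ⟨fun h => hm (h2 h), h3⟩
  · rw [Finset.sum_insert (fun h => hm (h1 h))]; ring

theorem mem_nearlyDoubledSums_of_mem {B : Finset ℤ} {v : ℤ} (hv : v ∈ B) :
    v ∈ nearlyDoubledSums B :=
  mem_nearlyDoubledSums.2 ⟨∅, {v}, by simp [hv]⟩

theorem two_mul_mem_nearlyDoubledSums {B : Finset ℤ} {v : ℤ} (hv : v ∈ B) :
    2 * v ∈ nearlyDoubledSums B :=
  mem_nearlyDoubledSums.2 ⟨{v}, ∅, by simp [hv]⟩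

theorem add_two_mul_mem_nearlyDoubledSums {B : Finset ℤ} {v w : ℤ} (hv : v ∈ B) (hw : w ∈ B)
    (hne : v ≠ w) : v + 2 * w ∈ nearlyDoubledSums B :=
  mem_nearlyDoubledSums.2 ⟨{w}, {v}, by simp [hv, hw, hne.symm, add_comm]⟩

theorem nonneg_of_mem_nearlyDoubledSums {B : Finset ℤ} (hB : ∀ v ∈ B, 0 < v) {t : ℤ}
    (ht : t ∈ nearlyDoubledSums B) : 0 ≤ t := by
  obtain ⟨X, Y, h1, h2, h3, h4, rfl⟩ := mem_nearlyDoubledSums.1 ht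
  have := Finset.sum_nonneg (s := X) (f := fun x => x) (fun x hx => (hB x (h1 hx)).le)
  have := Finset.sum_nonneg (s := Y) (f := fun x => x) (fun x hx => (hB x (h2 hx)).le)
  omega

/-- The old sums shifted by 2m are all at least 2m, hence disjoint from the sums below 2m. -/
theorem card_nearlyDoubledSums_insert {B : Finset ℤ} {m : ℤ} (hB : ∀ v ∈ B, 0 < v) (hm : m ∉ B) :
    (nearlyDoubledSums B).card + ((nearlyDoubledSums (insert m B)).filter (· < 2 * m)).card ≤
      (nearlyDoubledSums (insert m B)).card := by
  have hsub : (nearlyDoubledSums B).image (2 * m + ·) ∪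
      (nearlyDoubledSums (insert m B)).filter (· < 2 * m) ⊆ nearlyDoubledSums (insert m B) := by
    refine Finset.union_subset ?_ (Finset.filter_subset _ _)
    intro x hx
    obtain ⟨t, ht, rfl⟩ := Finset.mem_image.1 hx
    exact two_mul_add_mem_nearlyDoubledSums hm ht
  have hc := Finset.card_le_card hsub
  rw [Finset.card_union_of_disjoint, Finset.card_image_of_injective _ (add_right_injective _)] at hc
  · exact hc
  · rw [Finset.disjoint_left]
    intro x hx hx'
    obtain ⟨t, ht, rfl⟩ := Finset.mem_image.1 hx
    have := nonneg_of_mem_nearlyDoubledSums hB ht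
    have := (Finset.mem_filter.1 hx').2
    omega

theorem two_mul_card_le_card_filter_nearlyDoubledSums {B : Finset ℤ} {m : ℤ}
    (hpos : ∀ v ∈ B, 0 < v) (hm : m ∈ B) (hle : ∀ v ∈ B, v ≤ m) (h3 : 3 ≤ B.card) :
    2 * B.card ≤ ((nearlyDoubledSums B).filter (· < 2 * m)).card := by
  have hm0 := hpos m hm
  refine two_mul_card_le B _ m hm hpos hle h3 ?_ ?_ ?_ ?_
  · exact Finset.mem_filter.2 ⟨zero_mem_nearlyDoubledSums B, by omega⟩
  · intro v hv
    exact Finset.mem_filter.2 ⟨mem_nearlyDoubledSums_of_mem hv, by have := hle v hv; omega⟩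
  · intro v hv hlt
    exact Finset.mem_filter.2 ⟨two_mul_mem_nearlyDoubledSums hv, by omega⟩
  · intro v hv w hw hne hlt
    exact Finset.mem_filter.2 ⟨add_two_mul_mem_nearlyDoubledSums hv hw hne, hlt⟩

/-- A strictly increasing list of members of `s` bounds the cardinality of `s` from below. -/
theorem length_le_card_of_sorted {s : Finset ℤ} (l : List ℤ) (hl : l.Pairwise (· < ·))
    (hs : ∀ x ∈ l, x ∈ s) : l.length ≤ s.card := by
  rw [← List.toFinset_card_of_nodup (hl.imp (fun h => ne_of_lt h))]
  exact Finset.card_le_card (fun x hx => hs x (List.mem_toFinset.1 hx))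

theorem length_le_card_of_isChain {s : Finset ℤ} (l : List ℤ) (hl : l.IsChain (· < ·))
    (hs : ∀ x ∈ l, x ∈ s) : l.length ≤ s.card :=
  length_le_card_of_sorted l (List.isChain_iff_pairwise.1 hl) hs

theorem nearlyDoubledSums_pair {a b : ℤ} (hab : a < b) :
    ∀ x ∈ [0, a, 2 * a, b, 2 * b, a + 2 * b, b + 2 * a, 2 * a + 2 * b],
      x ∈ nearlyDoubledSums {a, b} := by
  have ha : a ∈ ({a, b} : Finset ℤ) := by simp
  have hb : b ∈ ({a, b} : Finset ℤ) := by simp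
  simp only [List.forall_mem_cons, List.not_mem_nil, false_imp_iff, implies_true, and_true]
  refine ⟨zero_mem_nearlyDoubledSums _, mem_nearlyDoubledSums_of_mem ha,
    two_mul_mem_nearlyDoubledSums ha, mem_nearlyDoubledSums_of_mem hb,
    two_mul_mem_nearlyDoubledSums hb, add_two_mul_mem_nearlyDoubledSums ha hb hab.ne,
    add_two_mul_mem_nearlyDoubledSums hb ha hab.ne', ?_⟩
  exact mem_nearlyDoubledSums.2 ⟨{a, b}, ∅, by simp [Finset.sum_pair hab.ne, mul_add]⟩

theorem eight_le_card_nearlyDoubledSums_pair {a b : ℤ} (ha : 0 < a) (hab : a < b)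
    (h : b ≠ 2 * a) : 8 ≤ (nearlyDoubledSums {a, b}).card := by
  have hm := nearlyDoubledSums_pair hab
  simp only [List.forall_mem_cons, List.not_mem_nil, false_imp_iff, implies_true, and_true] at hm
  rcases lt_or_gt_of_ne h with h | h
  · refine length_le_card_of_isChain [0, a, b, 2 * a, 2 * b, b + 2 * a, a + 2 * b, 2 * a + 2 * b]
      ?_ ?_
    · simp; omega
    · simp [hm]
  · refine length_le_card_of_isChain [0, a, 2 * a, b, b + 2 * a, 2 * b, a + 2 * b, 2 * a + 2 * b]
      ?_ ?_
    · simp; omega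
    · simp [hm]

theorem nearlyDoubledSums_triple {a b c : ℤ} (hab : a < b) (hbc : b < c) :
    ∀ x ∈ [0, a, 2 * a, b, 2 * b, a + 2 * b, b + 2 * a, 2 * a + 2 * b,
      2 * c, 2 * c + a, 2 * c + 2 * a, 2 * c + b, 2 * c + 2 * b, 2 * c + (a + 2 * b),
      2 * c + (b + 2 * a), 2 * c + (2 * a + 2 * b),
      c, c + 2 * a, c + 2 * b, c + 2 * a + 2 * b], x ∈ nearlyDoubledSums {c, a, b} := by
  have hc : c ∉ ({a, b} : Finset ℤ) := by simp; omega
  have hp := nearlyDoubledSums_pair hab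
  have h1 := fun x hx => nearlyDoubledSums_mono (Finset.subset_insert c {a, b}) (hp x hx)
  have h2 := fun x hx => two_mul_add_mem_nearlyDoubledSums hc (hp x hx)
  simp only [List.forall_mem_cons, List.not_mem_nil, false_imp_iff, implies_true, and_true,
    add_zero] at h1 h2 ⊢
  have hcc : c ∈ ({c, a, b} : Finset ℤ) := by simp
  have ha : a ∈ ({c, a, b} : Finset ℤ) := by simp
  have hb : b ∈ ({c, a, b} : Finset ℤ) := by simp
  have h3 := mem_nearlyDoubledSums_of_mem hcc
  have h4 := add_two_mul_mem_nearlyDoubledSums hcc ha (by omega)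
  have h5 := add_two_mul_mem_nearlyDoubledSums hcc hb (by omega)
  have h6 : c + 2 * a + 2 * b ∈ nearlyDoubledSums {c, a, b} :=
    mem_nearlyDoubledSums.2 ⟨{a, b}, {c}, by
      refine ⟨by simp, by simp, by simp; omega, by simp, ?_⟩
      rw [Finset.sum_pair hab.ne, Finset.sum_singleton]; ring⟩
  simp [h1, h2, h3, h4, h5, h6]

/-- If b ≠ 2a, the pair has 8 sums and `c` adds 6. If b = 2a, coincidences leave the pair only six
sums, so increasing lists are exhibited according to the position of `c` among the multiples of `a`.
-/
theorem thirteen_le_card_nearlyDoubledSums_triple {a b c : ℤ} (ha : 0 < a) (hab : a < b)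
    (hbc : b < c) (h : ¬ (b = 2 * a ∧ c = 4 * a)) :
    13 ≤ (nearlyDoubledSums {c, a, b}).card := by
  by_cases hb : b = 2 * a
  · subst hb
    have hm := nearlyDoubledSums_triple hab hbc
    have hc : c ≠ 4 * a := fun h' => h ⟨rfl, h'⟩
    generalize nearlyDoubledSums {c, a, 2 * a} = s at hm ⊢
    simp only [List.forall_mem_cons, List.not_mem_nil, false_imp_iff, implies_true, and_true] at hm
    ring_nf at hm
    have hl : ∀ l : List ℤ, 13 ≤ l.length → l.IsChain (· < ·) → (∀ x ∈ l, x ∈ s) → 13 ≤ s.card :=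
      fun l h1 h2 h3 => h1.trans (length_le_card_of_isChain l h2 h3)
    rcases lt_trichotomy c (3 * a) with h1 | h1 | h1
    · refine hl [0, a, a * 2, c, a * 4, a * 2 + c, a * 5, a + c * 2, a * 4 + c, a * 2 + c * 2,
        a * 6 + c, a * 4 + c * 2, a * 5 + c * 2, a * 6 + c * 2] (by simp) ?_ (by simp [hm])
      simp; omega
    · subst h1
      ring_nf at hm
      refine hl [0, a, a * 2, a * 3, a * 4, a * 5, a * 6, a * 7, a * 8, a * 9, a * 10, a * 11,
        a * 12] (by simp) ?_ (by simp [hm])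
      simp; omega
    rcases lt_or_gt_of_ne hc with h2 | h2
    · refine hl [0, a, a * 2, c, a * 4, a * 5, a * 2 + c, a * 4 + c, a + c * 2, a * 2 + c * 2,
        a * 6 + c, a * 4 + c * 2, a * 5 + c * 2, a * 6 + c * 2] (by simp) ?_ (by simp [hm])
      simp; omega
    rcases lt_trichotomy c (5 * a) with h3 | h3 | h3
    · refine hl [0, a, a * 2, a * 4, c, a * 5, a * 2 + c, a * 4 + c, a * 6 + c, a * 2 + c * 2,
        a * 4 + c * 2, a * 5 + c * 2, a * 6 + c * 2] (by simp) ?_ (by simp [hm])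
      simp; omega
    · refine hl [0, a, a * 2, a * 4, c, a * 6, a * 2 + c, a * 4 + c, a * 6 + c, a * 2 + c * 2,
        a * 4 + c * 2, a * 5 + c * 2, a * 6 + c * 2] (by simp) ?_ (by simp [hm])
      simp; omega
    · refine hl [0, a, a * 2, a * 4, a * 5, c, a * 2 + c, a * 4 + c, a * 6 + c, a * 2 + c * 2,
        a * 4 + c * 2, a * 5 + c * 2, a * 6 + c * 2] (by simp) ?_ (by simp [hm])
      simp; omega
  · have h1 := card_nearlyDoubledSums_insert (B := {a, b}) (m := c) (by simp; omega) (by simp; omega)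
    have hcard : ({c, a, b} : Finset ℤ).card = 3 :=
      Finset.card_eq_three.2 ⟨c, a, b, by omega, by omega, by omega, rfl⟩
    have h2 := two_mul_card_le_card_filter_nearlyDoubledSums (B := {c, a, b}) (m := c)
      (by simp; omega) (by simp) (by simp; omega) hcard.ge
    have h3 := eight_le_card_nearlyDoubledSums_pair ha hab hb
    omega

theorem twelve_le_card_nearlyDoubledSums_triple {a : ℤ} (ha : 0 < a) :
    12 ≤ (nearlyDoubledSums {4 * a, a, 2 * a}).card := by
  have hm := nearlyDoubledSums_triple (a := a) (b := 2 * a) (c := 4 * a) (by omega) (by omega)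
  generalize nearlyDoubledSums {4 * a, a, 2 * a} = s at hm ⊢
  simp only [List.forall_mem_cons, List.not_mem_nil, false_imp_iff, implies_true, and_true] at hm
  ring_nf at hm
  refine length_le_card_of_isChain [0, a, a * 2, a * 4, a * 5, a * 6, a * 8, a * 9, a * 10, a * 12,
    a * 13, a * 14] ?_ (by simp [hm])
  simp; omega

/-- One more than the general count of 8, making up for the sum missing from {a, 2a, 4a}: 12 + 9 =
13 + 8 = 21. -/
theorem nine_le_card_filter_nearlyDoubledSums {a d : ℤ} (ha : 0 < a) (hd : 4 * a < d) :
    9 ≤ ((nearlyDoubledSums {d, 4 * a, a, 2 * a}).filter (· < 2 * d)).card := by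
  have hm := fun x hx => nearlyDoubledSums_mono (Finset.subset_insert d {4 * a, a, 2 * a})
    (nearlyDoubledSums_triple (a := a) (b := 2 * a) (c := 4 * a) (by omega) (by omega) x hx)
  have hd0 : d ∈ ({d, 4 * a, a, 2 * a} : Finset ℤ) := by simp
  have h1 := mem_nearlyDoubledSums_of_mem hd0
  have h2 : d + 2 * a ∈ nearlyDoubledSums {d, 4 * a, a, 2 * a} :=
    add_two_mul_mem_nearlyDoubledSums hd0 (by simp) (by omega)
  generalize nearlyDoubledSums {d, 4 * a, a, 2 * a} = s at hm h1 h2 ⊢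
  simp only [List.forall_mem_cons, List.not_mem_nil, false_imp_iff, implies_true, and_true] at hm
  ring_nf at hm h2
  have hl : ∀ l : List ℤ, 9 ≤ l.length → l.IsChain (· < ·) → (∀ x ∈ l, x ∈ s) →
      (∀ x ∈ l, x < 2 * d) → 9 ≤ (s.filter (· < 2 * d)).card :=
    fun l h1 h2 h3 h4 => h1.trans (length_le_card_of_isChain l h2
      (fun x hx => Finset.mem_filter.2 ⟨h3 x hx, h4 x hx⟩))
  rcases lt_trichotomy d (5 * a) with h4 | h4 | h4
  · refine hl [0, a, a * 2, a * 4, d, a * 5, a * 6, a * 2 + d, a * 8] (by simp) ?_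
      (by simp [hm, h1, h2]) ?_
    all_goals simp; omega
  · refine hl [0, a, a * 2, a * 4, a * 5, a * 6, a * 2 + d, a * 8, a * 9] (by simp) ?_
      (by simp [hm, h2]) ?_
    all_goals simp; omega
  rcases lt_trichotomy d (6 * a) with h5 | h5 | h5
  · refine hl [0, a, a * 2, a * 4, a * 5, d, a * 6, a * 2 + d, a * 8] (by simp) ?_
      (by simp [hm, h1, h2]) ?_
    all_goals simp; omega
  · refine hl [0, a, a * 2, a * 4, a * 5, a * 6, a * 8, a * 9, a * 10] (by simp) ?_
      (by simp [hm]) ?_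
    all_goals simp; omega
  rcases lt_trichotomy d (8 * a) with h6 | h6 | h6
  · refine hl [0, a, a * 2, a * 4, a * 5, a * 6, d, a * 8, a * 2 + d] (by simp) ?_
      (by simp [hm, h1, h2]) ?_
    all_goals simp; omega
  · refine hl [0, a, a * 2, a * 4, a * 5, a * 6, a * 8, a * 9, a * 10] (by simp) ?_
      (by simp [hm]) ?_
    all_goals simp; omega
  · refine hl [0, a, a * 2, a * 4, a * 5, a * 6, a * 8, d, a * 2 + d] (by simp) ?_
      (by simp [hm, h1, h2]) ?_
    all_goals simp; omega

/-- A nonempty finite set of positive integers is a smaller one with a new maximum inserted. -/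
theorem exists_eq_insert_max {B : Finset ℤ} {n : ℕ} (hB : B.card = n + 1) :
    ∃ (m : ℤ) (C : Finset ℤ), B = insert m C ∧ m ∉ C ∧ (∀ v ∈ C, v < m) ∧ C.card = n := by
  have hne : B.Nonempty := Finset.card_pos.1 (by omega)
  refine ⟨B.max' hne, B.erase (B.max' hne), ?_, ?_, ?_, ?_⟩
  · rw [Finset.insert_erase (B.max'_mem hne)]
  · simp
  · intro v hv
    exact Finset.lt_max'_of_mem_erase_max' B hne hv
  · rw [Finset.card_erase_of_mem (B.max'_mem hne), hB]; rfl

theorem exists_eq_triple {B : Finset ℤ} (hB : B.card = 3) :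
    ∃ a b c : ℤ, a < b ∧ b < c ∧ B = {c, a, b} := by
  obtain ⟨c, B', rfl, -, hc, hB'⟩ := exists_eq_insert_max hB
  obtain ⟨b, B'', rfl, -, hb, hB''⟩ := exists_eq_insert_max hB'
  obtain ⟨a, rfl⟩ := Finset.card_eq_one.1 hB''
  exact ⟨a, b, c, hb a (by simp), hc b (by simp), by rw [Finset.pair_comm]⟩

theorem le_card_nearlyDoubledSums {B : Finset ℤ} {n : ℕ} (hB : ∀ v ∈ B, 0 < v)
    (hn : B.card = n) (h4 : 4 ≤ n) : n * (n + 1) + 1 ≤ (nearlyDoubledSums B).card := by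
  induction n, h4 using Nat.le_induction generalizing B with
  | base =>
    obtain ⟨d, C, rfl, hdC, hd, hC⟩ := exists_eq_insert_max hn
    have hCpos : ∀ v ∈ C, 0 < v := fun v hv => hB v (Finset.mem_insert_of_mem hv)
    have h1 := card_nearlyDoubledSums_insert hCpos hdC
    have h2 := two_mul_card_le_card_filter_nearlyDoubledSums hB (Finset.mem_insert_self d C)
      (by simp only [Finset.mem_insert, forall_eq_or_imp, le_refl, true_and]
          exact fun v hv => (hd v hv).le) (by omega)
    obtain ⟨a, b, c, hab, hbc, rfl⟩ := exists_eq_triple hC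
    have ha : 0 < a := hCpos a (by simp)
    by_cases h : b = 2 * a ∧ c = 4 * a
    · obtain ⟨rfl, rfl⟩ := h
      have := twelve_le_card_nearlyDoubledSums_triple ha
      have := nine_le_card_filter_nearlyDoubledSums ha (hd (4 * a) (by simp))
      omega
    · have := thirteen_le_card_nearlyDoubledSums_triple ha hab hbc h
      omega
  | succ n h4 ih =>
    obtain ⟨m, C, rfl, hmC, hm, hC⟩ := exists_eq_insert_max hn
    have hCpos : ∀ v ∈ C, 0 < v := fun v hv => hB v (Finset.mem_insert_of_mem hv)
    have h1 := card_nearlyDoubledSums_insert hCpos hmC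
    have h2 := two_mul_card_le_card_filter_nearlyDoubledSums hB (Finset.mem_insert_self m C)
      (by simp only [Finset.mem_insert, forall_eq_or_imp, le_refl, true_and]
          exact fun v hv => (hm v hv).le) (by omega)
    have h3 := ih hCpos hC
    rw [hn] at h2
    linarith

/-! ### Signed sums and the induction on n. -/

/-- The sums `∑ P - ∑ N` over disjoint `P, N ⊆ B` with `#P + #N ∈ {h - 1, h}`: the restricted
`h`-fold signed sumset of `B ∪ {0}`. -/
def signedSums (h : ℕ) (B : Finset ℤ) : Finset ℤ :=
  ((B.powerset ×ˢ B.powerset).filter (fun p => Disjoint p.1 p.2 ∧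
    (p.1.card + p.2.card = h ∨ p.1.card + p.2.card + 1 = h))).image
    (fun p => ∑ x ∈ p.1, x - ∑ x ∈ p.2, x)

theorem mem_signedSums {h : ℕ} {B : Finset ℤ} {t : ℤ} :
    t ∈ signedSums h B ↔ ∃ P N : Finset ℤ, P ⊆ B ∧ N ⊆ B ∧ Disjoint P N ∧
      (P.card + N.card = h ∨ P.card + N.card + 1 = h) ∧ t = ∑ x ∈ P, x - ∑ x ∈ N, x := by
  simp only [signedSums, Finset.mem_image, Finset.mem_filter, Finset.mem_product,
    Finset.mem_powerset, Prod.exists]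
  constructor
  · rintro ⟨X, Y, ⟨⟨h1, h2⟩, h3, h4⟩, h5⟩
    exact ⟨X, Y, h1, h2, h3, h4, h5.symm⟩
  · rintro ⟨X, Y, h1, h2, h3, h4, h5⟩
    exact ⟨X, Y, ⟨⟨h1, h2⟩, h3, h4⟩, h5.symm⟩

theorem signedSums_mono {h : ℕ} {B C : Finset ℤ} (hBC : B ⊆ C) :
    signedSums h B ⊆ signedSums h C := by
  intro t ht
  obtain ⟨X, Y, h1, h2, h3⟩ := mem_signedSums.1 ht
  exact mem_signedSums.2 ⟨X, Y, h1.trans hBC, h2.trans hBC, h3⟩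

theorem neg_mem_signedSums {h : ℕ} {B : Finset ℤ} {t : ℤ} (ht : t ∈ signedSums h B) :
    -t ∈ signedSums h B := by
  obtain ⟨P, N, h1, h2, h3, h4, rfl⟩ := mem_signedSums.1 ht
  exact mem_signedSums.2 ⟨N, P, h2, h1, h3.symm, by omega, by ring⟩

theorem sum_mem_signedSums {h : ℕ} {B P : Finset ℤ} (hP : P ⊆ B)
    (hc : P.card = h ∨ P.card + 1 = h) : ∑ x ∈ P, x ∈ signedSums h B :=
  mem_signedSums.2 ⟨P, ∅, by simpa using ⟨hP, hc⟩⟩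

/-- Subtracting from the total of `B` turns coefficients 0, 1, 2 into 1, 0, -1; at most one 1
becomes at most one 0. -/
theorem card_nearlyDoubledSums_le (B : Finset ℤ) :
    (nearlyDoubledSums B).card ≤ (signedSums B.card B).card := by
  rw [← Finset.card_image_of_injective (nearlyDoubledSums B) (sub_right_injective (b := ∑ x ∈ B, x))]
  refine Finset.card_le_card ?_
  intro x hx
  obtain ⟨t, ht, rfl⟩ := Finset.mem_image.1 hx
  obtain ⟨X, Y, h1, h2, h3, h4, rfl⟩ := mem_nearlyDoubledSums.1 ht
  have hXY : X ∪ Y ⊆ B := Finset.union_subset h1 h2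
  have hc := Finset.card_sdiff_add_card_eq_card hXY
  have hs := Finset.sum_sdiff (f := fun x : ℤ => x) hXY
  rw [Finset.card_union_of_disjoint h3] at hc
  rw [Finset.sum_union h3] at hs
  refine mem_signedSums.2 ⟨B \ (X ∪ Y), X, Finset.sdiff_subset, h1, ?_, by omega, ?_⟩
  · exact Finset.disjoint_left.2 fun x hx hx' =>
      (Finset.mem_sdiff.1 hx).2 (Finset.mem_union_left _ hx')
  · linarith

theorem exists_max_subset_sum {B : Finset ℤ} {h : ℕ} (hB : ∀ v ∈ B, 0 < v) (hh : h ≤ B.card) :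
    ∃ C ⊆ B, C.card = h ∧ ∀ t ∈ signedSums h B, t ≤ ∑ x ∈ C, x := by
  obtain ⟨C, hC, hmax⟩ := (B.powersetCard h).exists_max_image (fun P => ∑ x ∈ P, x)
    (Finset.powersetCard_nonempty.2 hh)
  obtain ⟨hCB, hCc⟩ := Finset.mem_powersetCard.1 hC
  refine ⟨C, hCB, hCc, fun t ht => ?_⟩
  obtain ⟨P, N, h1, h2, h3, h4, rfl⟩ := mem_signedSums.1 ht
  obtain ⟨P', hP, hP', hc⟩ := Finset.exists_subsuperset_card_eq h1 (n := h) (by omega) hh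
  have := hmax P' (Finset.mem_powersetCard.2 ⟨hP', hc⟩)
  have := Finset.sum_le_sum_of_subset_of_nonneg (f := fun x : ℤ => x) hP
    (fun x hx _ => (hB x (hP' hx)).le)
  have := Finset.sum_nonneg (s := N) (f := fun x => x) (fun x hx => (hB x (h2 hx)).le)
  linarith

/-- For an h-subset `C` of largest sum, replacing any c in `C` by m > c beats every old sum. The h
sums obtained are distinct, and so are their negatives, which lie below every old sum. -/
theorem card_signedSums_insert {B : Finset ℤ} {m : ℤ} {h : ℕ} (hB : ∀ v ∈ B, 0 < v)
    (hm : ∀ v ∈ B, v < m) (hh : h ≤ B.card) :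
    (signedSums h B).card + 2 * h ≤ (signedSums h (insert m B)).card := by
  obtain ⟨C, hCB, hCc, hmax⟩ := exists_max_subset_sum hB hh
  have hC0 := Finset.sum_nonneg (s := C) (f := fun x => x) (fun x hx => (hB x (hCB hx)).le)
  have hmC : m ∉ C := fun h => lt_irrefl m (hm m (hCB h))
  set I := C.image (fun c => m + ∑ x ∈ C, x - c) with hI
  have hIgt : ∀ x ∈ I, ∑ x ∈ C, x < x := by
    intro x hx
    obtain ⟨c, hc, rfl⟩ := Finset.mem_image.1 hx
    have := hm c (hCB hc)
    omega
  have hIc : I.card = h := by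
    rw [hI, Finset.card_image_of_injective _ (sub_right_injective), hCc]
  have hIS : I ⊆ signedSums h (insert m B) := by
    intro x hx
    obtain ⟨c, hc, rfl⟩ := Finset.mem_image.1 hx
    have hmc : m ∉ C.erase c := fun h => hmC (Finset.mem_of_mem_erase h)
    have hcard := Finset.card_erase_add_one hc
    have := sum_mem_signedSums (h := h) (B := insert m B) (P := insert m (C.erase c))
      (Finset.insert_subset_insert _ ((Finset.erase_subset _ _).trans hCB))
      (by rw [Finset.card_insert_of_notMem hmc]; omega)
    rw [Finset.sum_insert hmc] at this
    have hs := Finset.sum_erase_add C (fun x => x) hc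
    rwa [show m + ∑ x ∈ C, x - c = m + ∑ x ∈ C.erase c, x by linarith]
  have hIneg : I.image Neg.neg ⊆ signedSums h (insert m B) := by
    intro x hx
    obtain ⟨y, hy, rfl⟩ := Finset.mem_image.1 hx
    exact neg_mem_signedSums (hIS hy)
  have hd1 : Disjoint (signedSums h B) I := Finset.disjoint_left.2 fun x hx hx' =>
    absurd (hmax x hx) (not_le.2 (hIgt x hx'))
  have hd2 : Disjoint (signedSums h B ∪ I) (I.image Neg.neg) := by
    refine Finset.disjoint_left.2 fun x hx hx' => ?_
    obtain ⟨y, hy, rfl⟩ := Finset.mem_image.1 hx'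
    have h1 := hIgt y hy
    rcases Finset.mem_union.1 hx with h2 | h2
    · have := hmax _ (neg_mem_signedSums h2)
      rw [neg_neg] at this
      omega
    · have := hIgt _ h2
      omega
  have hc := Finset.card_le_card (Finset.union_subset (Finset.union_subset
    (signedSums_mono (h := h) (Finset.subset_insert m B)) hIS) hIneg)
  rw [Finset.card_union_of_disjoint hd2, Finset.card_union_of_disjoint hd1,
    Finset.card_image_of_injective _ neg_injective, hIc] at hc
  omega

/-- A generic triple gives 13 + 6. For {a, 2a, 4a} the same count stops at 18, so 19 sums are
listed. -/
theorem nineteen_le_card_signedSums {B : Finset ℤ} (hB : ∀ v ∈ B, 0 < v) (hc : B.card = 4) :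
    19 ≤ (signedSums 3 B).card := by
  obtain ⟨d, C, rfl, hdC, hd, hC⟩ := exists_eq_insert_max hc
  have hCpos : ∀ v ∈ C, 0 < v := fun v hv => hB v (Finset.mem_insert_of_mem hv)
  have h1 := card_signedSums_insert hCpos hd hC.ge
  have h2 := card_nearlyDoubledSums_le C
  rw [hC] at h2
  obtain ⟨a, b, c, hab, hbc, rfl⟩ := exists_eq_triple hC
  have ha : 0 < a := hCpos a (by simp)
  by_cases h : b = 2 * a ∧ c = 4 * a
  · obtain ⟨rfl, rfl⟩ := h
    have hd4 : 4 * a < d := hd _ (by simp)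
    have h2' : ∀ x y : ℤ, x ∈ ({d, 4 * a, a, 2 * a} : Finset ℤ) →
        y ∈ ({d, 4 * a, a, 2 * a} : Finset ℤ) → x ≠ y →
        x + y ∈ signedSums 3 {d, 4 * a, a, 2 * a} := by
      intro x y hx hy hxy
      rw [← Finset.sum_pair (f := fun x => x) hxy]
      exact sum_mem_signedSums (by simp [Finset.insert_subset_iff] at *; exact ⟨hx, hy⟩)
        (by rw [Finset.card_pair hxy]; omega)
    have h3' : ∀ x y z : ℤ, x ∈ ({d, 4 * a, a, 2 * a} : Finset ℤ) →
        y ∈ ({d, 4 * a, a, 2 * a} : Finset ℤ) → z ∈ ({d, 4 * a, a, 2 * a} : Finset ℤ) →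
        x ≠ y → x ≠ z → y ≠ z → x + y + z ∈ signedSums 3 {d, 4 * a, a, 2 * a} ∧
          x + y - z ∈ signedSums 3 {d, 4 * a, a, 2 * a} := by
      intro x y z hx hy hz hxy hxz hyz
      have hxy' : ({x, y} : Finset ℤ) ⊆ {d, 4 * a, a, 2 * a} := by
        rw [Finset.insert_subset_iff, Finset.singleton_subset_iff]; exact ⟨hx, hy⟩
      have hz' : ({z} : Finset ℤ) ⊆ {d, 4 * a, a, 2 * a} := Finset.singleton_subset_iff.2 hz
      have hdis : Disjoint ({x, y} : Finset ℤ) {z} := by simp; omega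
      constructor
      · have := sum_mem_signedSums (h := 3) (Finset.union_subset hxy' hz')
          (by rw [Finset.card_union_of_disjoint hdis, Finset.card_pair hxy]; simp)
        rwa [Finset.sum_union hdis, Finset.sum_pair hxy, Finset.sum_singleton] at this
      · refine mem_signedSums.2 ⟨{x, y}, {z}, hxy', hz', hdis, ?_, ?_⟩
        · rw [Finset.card_pair hxy]; simp
        · rw [Finset.sum_pair hxy, Finset.sum_singleton]
    have e1 := h2' (4 * a) (2 * a) (by simp) (by simp) (by omega)
    have e2 := h2' (4 * a) a (by simp) (by simp) (by omega)
    have e3 := h2' (2 * a) a (by simp) (by simp) (by omega)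
    have e4 := h2' d (4 * a) (by simp) (by simp) (by omega)
    have e5 := (h3' (4 * a) (2 * a) a (by simp) (by simp) (by simp) (by omega) (by omega)
      (by omega)).1
    have e7 := (h3' (2 * a) a (4 * a) (by simp) (by simp) (by simp) (by omega) (by omega)
      (by omega)).2
    have e8 := (h3' d (2 * a) a (by simp) (by simp) (by simp) (by omega) (by omega)
      (by omega)).1
    have e9 := (h3' d (4 * a) a (by simp) (by simp) (by simp) (by omega) (by omega)
      (by omega)).1
    have e10 := (h3' d (4 * a) (2 * a) (by simp) (by simp) (by simp) (by omega) (by omega)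
      (by omega)).1
    have e11 : 4 * a - 2 * a ∈ signedSums 3 {d, 4 * a, a, 2 * a} :=
      mem_signedSums.2 ⟨{4 * a}, {2 * a}, by simp, by simp, by simp; omega, by simp, by simp⟩
    have hneg : ∀ t, t ∈ signedSums 3 {d, 4 * a, a, 2 * a} →
      -t ∈ signedSums 3 {d, 4 * a, a, 2 * a} := fun t => neg_mem_signedSums
    generalize signedSums 3 {d, 4 * a, a, 2 * a} = s at *
    ring_nf at e1 e2 e3 e4 e5 e7 e8 e9 e10 e11
    have e7' := hneg _ e7
    rw [neg_neg] at e7'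
    refine le_trans (by simp) (length_le_card_of_isChain (s := s)
      [-(a * 5 + d), -(a * 4 + d), -(a * 3 + d), -(a * 7), -(a * 6), -(a * 5), -(a * 3), -(a * 2), -a, a, a * 2,
        a * 3, a * 5, a * 6, a * 7, a * 3 + d, a * 4 + d, a * 5 + d, a * 6 + d] ?_ ?_)
    · simp; omega
    · simp [*, -neg_add_rev]
  · have := thirteen_le_card_nearlyDoubledSums_triple ha hab hbc h
    omega

theorem le_card_signedSums {B : Finset ℤ} {h n : ℕ} (hB : ∀ v ∈ B, 0 < v) (hc : B.card = n)
    (h3 : 3 ≤ h) (h4 : 4 ≤ n) (hn : h ≤ n) :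
    2 * (h : ℤ) * n - h * (h - 1) + 1 ≤ (signedSums h B).card := by
  -- Going from n to n + 1 raises the bound by exactly 2h, so it suffices to start at some n₀ ≥ h.
  have hstep : ∀ n₀ : ℕ, h ≤ n₀ → (∀ B : Finset ℤ, (∀ v ∈ B, 0 < v) → B.card = n₀ →
      2 * (h : ℤ) * n₀ - h * (h - 1) + 1 ≤ (signedSums h B).card) → n₀ ≤ n →
      2 * (h : ℤ) * n - h * (h - 1) + 1 ≤ (signedSums h B).card := by
    intro n₀ hn₀ hbase hle
    clear hn h4
    induction n, hle using Nat.le_induction generalizing B with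
    | base => exact hbase B hB hc
    | succ n hle ih =>
      obtain ⟨m, C, rfl, hmC, hm, hC⟩ := exists_eq_insert_max hc
      have hCpos : ∀ v ∈ C, 0 < v := fun v hv => hB v (Finset.mem_insert_of_mem hv)
      have h1 := ih hCpos hC
      have h2 := card_signedSums_insert (h := h) hCpos hm (by omega)
      zify at h2
      push_cast
      linarith
  by_cases hh : h = 3
  · subst hh
    refine hstep 4 (by omega) (fun B hB hc => ?_) h4
    have := nineteen_le_card_signedSums hB hc
    norm_num
    exact_mod_cast this
  · refine hstep h le_rfl (fun B hB hc => ?_) hn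
    have h1 := le_card_nearlyDoubledSums hB hc (by omega)
    have h2 := card_nearlyDoubledSums_le B
    rw [hc] at h2
    zify at h1 h2
    linarith

/-! ### Passage from `A` to absolute values. -/

theorem signedSums_subset_restrictedSignedSumset {A : Finset ℤ} (h0 : 0 ∈ A)
    (hA : ∀ a ∈ A, -a ∈ A → a = 0) (h : ℕ) :
    ↑(signedSums h ((A.erase 0).image abs)) ⊆ restrictedSignedSumset h A := by
  intro x hx
  obtain ⟨P, N, hP, hN, hd, hc, rfl⟩ := mem_signedSums.1 (Finset.mem_coe.1 hx)
  have hinj : Set.InjOn (abs : ℤ → ℤ) (A.erase 0 : Finset ℤ) := by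
    intro a ha b hb hab
    rw [Finset.mem_coe, Finset.mem_erase] at ha hb
    rcases abs_eq_abs.1 hab with h | h
    · exact h
    · exact absurd (hA b hb.2 (h ▸ ha.2)) hb.1
  have hPN : ∀ b, b ∈ P → b ∉ N := fun _ => (Finset.disjoint_left.1 hd ·)
  set g : ℤ → ℤ := fun b => (if b ∈ P then 1 else 0) - (if b ∈ N then 1 else 0) with hg
  have hgabs : ∀ b, |g b| = (if b ∈ P then 1 else 0) + (if b ∈ N then 1 else 0) := by
    intro b
    have := hPN b
    by_cases h1 : b ∈ P <;> by_cases h2 : b ∈ N <;> simp_all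
  have hg1 : ∀ b, g b = -1 ∨ g b = 0 ∨ g b = 1 := by
    intro b
    by_cases h1 : b ∈ P <;> by_cases h2 : b ∈ N <;> simp [hg, h1, h2]
  -- The coefficient of 0 is 0 or 1 and brings the number of summands up to h without altering the
  -- sum.
  set c : ℤ → ℤ := fun a => if a = 0 then (h : ℤ) - P.card - N.card else a.sign * g (|a|) with hcdef
  have hc0 : c 0 = (h : ℤ) - P.card - N.card := by simp [hcdef]
  have hc1 : ∀ a ∈ A.erase 0, c a = a.sign * g (|a|) := by
    intro a ha
    simp [hcdef, (Finset.mem_erase.1 ha).1]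
  refine ⟨c, ?_, ?_, ?_⟩
  · intro a ha
    by_cases h0 : a = 0
    · rw [h0, hc0]; omega
    · rw [hc1 a (Finset.mem_erase.2 ⟨h0, ha⟩)]
      rcases lt_or_gt_of_ne h0 with h | h
      · rw [Int.sign_eq_neg_one_of_neg h]
        have := hg1 (|a|)
        omega
      · rw [Int.sign_eq_one_of_pos h]
        have := hg1 (|a|)
        omega
  · have : ∑ a ∈ A.erase 0, |c a| = P.card + N.card := by
      calc ∑ a ∈ A.erase 0, |c a| = ∑ a ∈ A.erase 0, |g (|a|)| := by
            refine Finset.sum_congr rfl fun a ha => ?_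
            rw [hc1 a ha, abs_mul, Int.abs_sign_of_ne_zero (Finset.mem_erase.1 ha).1, one_mul]
        _ = ∑ b ∈ (A.erase 0).image abs, |g b| :=
            (Finset.sum_image (f := fun b => |g b|) hinj).symm
        _ = _ := by
            simp only [hgabs, Finset.sum_add_distrib, Finset.sum_ite_mem,
              Finset.inter_eq_right.2 hP, Finset.inter_eq_right.2 hN]
            simp
    rw [← Finset.sum_erase_add A _ h0, this, hc0, abs_of_nonneg (by omega)]
    ring
  · have : ∑ a ∈ A.erase 0, c a • a = ∑ x ∈ P, x - ∑ x ∈ N, x := by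
      calc ∑ a ∈ A.erase 0, c a • a = ∑ a ∈ A.erase 0, g (|a|) * (|a|) := by
            refine Finset.sum_congr rfl fun a ha => ?_
            rw [hc1 a ha, smul_eq_mul, ← Int.sign_mul_self_eq_abs]; ring
        _ = ∑ b ∈ (A.erase 0).image abs, g b * b :=
            (Finset.sum_image (f := fun b => g b * b) hinj).symm
        _ = _ := by
            simp only [hg, sub_mul, ite_mul, one_mul, zero_mul, Finset.sum_sub_distrib,
              Finset.sum_ite_mem, Finset.inter_eq_right.2 hP, Finset.inter_eq_right.2 hN]
    rw [← Finset.sum_erase_add A _ h0, this]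
    simp

/-! ### Sharpness for the interval {0, ..., k - 1}. -/

theorem sum_max_sub_range (t h : ℕ) :
    2 * ∑ a ∈ Finset.range (t + h + 1), max ((a : ℤ) - t) 0 = h * (h + 1) := by
  induction h with
  | zero =>
    have : ∑ a ∈ Finset.range (t + 0 + 1), max ((a : ℤ) - t) 0 = 0 :=
      Finset.sum_eq_zero fun a ha => by
        have := Finset.mem_range.1 ha
        exact max_eq_right (by omega)
    rw [this]; simp
  | succ h ih =>
    rw [← add_assoc, Finset.sum_range_succ, mul_add, ih, max_eq_left (by push_cast; omega)]
    push_cast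
    ring

/-- With k = t + h + 1, writing each a as t + (a - t) gives a contribution ht plus at most the sum
of the positive parts of a - t, which is 1 + ... + h. -/
theorem abs_le_of_mem_restrictedSignedSumset_range {t h : ℕ} {x : ℤ}
    (hx : x ∈ restrictedSignedSumset h ((Finset.range (t + h + 1)).image (Nat.cast : ℕ → ℤ))) :
    2 * |x| ≤ 2 * h * t + h * (h + 1) := by
  obtain ⟨c, hc, hs, rfl⟩ := hx
  have hinj : Set.InjOn (Nat.cast : ℕ → ℤ) (Finset.range (t + h + 1) : Finset ℕ) :=
    Nat.cast_injective.injOn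
  rw [Finset.sum_image hinj] at hs ⊢
  have hc' : ∀ a ∈ Finset.range (t + h + 1), |c a| = 0 ∨ |c a| = 1 := by
    intro a ha
    rcases hc a (Finset.mem_image_of_mem _ ha) with h | h | h <;> simp [h]
  have h1 : |∑ a ∈ Finset.range (t + h + 1), c a • (a : ℤ)| ≤
      ∑ a ∈ Finset.range (t + h + 1), |c a| * a := by
    refine (Finset.abs_sum_le_sum_abs _ _).trans (Finset.sum_le_sum fun a _ => ?_)
    rw [smul_eq_mul, abs_mul, Nat.abs_cast]
  have h2 : ∑ a ∈ Finset.range (t + h + 1), |c a| * ((a : ℤ) - t) ≤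
      ∑ a ∈ Finset.range (t + h + 1), max ((a : ℤ) - t) 0 := by
    refine Finset.sum_le_sum fun a ha => ?_
    rcases hc' a ha with h | h <;> simp [h]
  have h3 := sum_max_sub_range t h
  simp only [mul_sub, Finset.sum_sub_distrib, ← Finset.sum_mul, hs] at h2
  linarith

theorem mainTheorem4 (h k : ℕ) (hh : 3 ≤ h) (hhk : (h : ℤ) ≤ (k : ℤ) - 1) (hk : 5 ≤ k) :
    (∀ A : Finset ℤ, A.card = k → A ∩ (-A) = {0} →
      2 * (h : ℤ) * (k : ℤ) - (h : ℤ) * ((h : ℤ) + 1) + 1 ≤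
        ((restrictedSignedSumset h A).ncard : ℤ)) ∧
    (∃ A : Finset ℤ, A.card = k ∧ A ∩ (-A) = {0} ∧
      ((restrictedSignedSumset h A).ncard : ℤ) =
        2 * (h : ℤ) * (k : ℤ) - (h : ℤ) * ((h : ℤ) + 1) + 1) := by
  have lower : ∀ A : Finset ℤ, A.card = k → A ∩ (-A) = {0} →
      2 * (h : ℤ) * (k : ℤ) - (h : ℤ) * ((h : ℤ) + 1) + 1 ≤
        ((restrictedSignedSumset h A).ncard : ℤ) := by
    intro A hAk hA
    have hmem : ∀ a, (a ∈ A ∧ -a ∈ A) ↔ a = 0 := by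
      intro a
      rw [← Finset.mem_singleton, ← hA, Finset.mem_inter, Finset.mem_neg']
    have h0 : 0 ∈ A := ((hmem 0).2 rfl).1
    have hA' : ∀ a ∈ A, -a ∈ A → a = 0 := fun a h1 h2 => (hmem a).1 ⟨h1, h2⟩
    have hcard : ((A.erase 0).image abs).card = k - 1 := by
      rw [Finset.card_image_of_injOn, Finset.card_erase_of_mem h0, hAk]
      intro a ha b hb hab
      rw [Finset.mem_coe, Finset.mem_erase] at ha hb
      rcases abs_eq_abs.1 hab with h | h
      · exact h
      · exact absurd (hA' b hb.2 (h ▸ ha.2)) hb.1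
    have hpos : ∀ v ∈ (A.erase 0).image abs, 0 < v := by
      intro v hv
      obtain ⟨a, ha, rfl⟩ := Finset.mem_image.1 hv
      exact abs_pos.2 (Finset.mem_erase.1 ha).1
    have h1 := le_card_signedSums hpos hcard hh (by omega) (by omega)
    have h2 := Set.ncard_le_ncard (signedSums_subset_restrictedSignedSumset h0 hA' h)
      (restrictedSignedSumset_finite h A)
    rw [Set.ncard_coe_finset] at h2
    zify at h2
    refine le_trans (le_of_eq ?_) (h1.trans h2)
    rw [Nat.cast_sub (by omega)]
    push_cast
    ring
  refine ⟨lower, ?_⟩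
  obtain ⟨t, rfl⟩ : ∃ t, k = t + h + 1 := ⟨k - 1 - h, by omega⟩
  have hcard : ((Finset.range (t + h + 1)).image (Nat.cast : ℕ → ℤ)).card = t + h + 1 := by
    rw [Finset.card_image_of_injective _ Nat.cast_injective, Finset.card_range]
  have hA : (Finset.range (t + h + 1)).image (Nat.cast : ℕ → ℤ) ∩
      -(Finset.range (t + h + 1)).image (Nat.cast : ℕ → ℤ) = {0} := by
    ext a
    simp only [Finset.mem_inter, Finset.mem_neg', Finset.mem_image, Finset.mem_range,
      Finset.mem_singleton]
    constructor
    · rintro ⟨⟨x, -, hx⟩, y, -, hy⟩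
      omega
    · rintro rfl
      exact ⟨⟨0, by omega, by simp⟩, 0, by omega, by simp⟩
  refine ⟨_, hcard, hA, le_antisymm ?_ (lower _ hcard hA)⟩
  -- `M` is h(h + 1) / 2, so ht + M is the sum of the h largest elements.
  obtain ⟨M, hM⟩ := (Int.even_mul_succ_self h)
  have hsub : restrictedSignedSumset h ((Finset.range (t + h + 1)).image (Nat.cast : ℕ → ℤ)) ⊆
      ↑(Finset.Icc (-(h * t + M)) (h * t + M)) := by
    intro x hx
    have := abs_le_of_mem_restrictedSignedSumset_range hx
    rw [Finset.coe_Icc, Set.mem_Icc, ← abs_le]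
    linarith
  have h1 := Set.ncard_le_ncard hsub (Finset.finite_toSet _)
  rw [Set.ncard_coe_finset, Int.card_Icc] at h1
  have hM0 : 0 ≤ (h : ℤ) * t + M := by
    have : 0 ≤ (h : ℤ) * (h + 1) := by positivity
    have : 0 ≤ (h : ℤ) * t := by positivity
    linarith
  zify at h1
  rw [Int.toNat_of_nonneg (by omega)] at h1
  push_cast
  linarith
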